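/- Let $s\ge 2$ and let $K_{n_1,\dots,n_s}$ be the complete multipartite graph with parts $X_1,\dots,X_s$, where $|X_i|=n_i\ge 1$, and put $n=n_1+\cdots+n_s$. Let $F$ be a spanning forest of $K_{n_1,\dots,n_s}$ (an acyclic subgraph containing all vertices) with components $T_1,\dots,T_c$. Put $n_{ip}=|X_i\cap V(T_p)|$, $m_p=|V(T_p)|$ and $\alpha_p=nm_p-\sum_{i=1}^s n_in_{ip}$, and let $Z(x)$ be the real $s\times s$ matrix with entries $$z_{ij}(x)=\delta_{ij}+\sum_{p=1}^c\frac{n_{jp}(m_p-n_{ip})}{x-\alpha_p}.$$ Then $Z(0)$ has rank $s-1$. Moreover, with $\mathbf{e}=(1,\dots,1)^{\top}$ and $\mathbf{b}=(n_1,\dots,n_s)^{\top}$, there is a constant $\gamma\in\mathbb{R}$ such that $$\operatorname{adj} Z(0)=\gamma\,(n\mathbf{e}-\mathbf{b})\mathbf{b}^{\top},$$ and for all $i,j\in\{1,\dots,s\}$ $$\gamma=\frac{C_{ij}}{n_i(n-n_j)},$$ where $C_{ij}$ is the cofactor of $Z(0)$ corresponding to the $(i,j)$ entry, that is, $(-1)^{i+j}$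 times the determinant of $Z(0)$ with row $i$ and column $j$ deleted. -/

import Mathlib

namespace MultipartiteForest

/-- The number `n_i` of vertices in the `i`-th part `X i`. -/
def partSize {s : ℕ} (X : Fin s → Type*) [∀ i, Fintype (X i)] (i : Fin s) : ℕ :=
  Fintype.card (X i)

/-- The number `n = n_1 + ... + n_s` of all vertices. -/
def order {s : ℕ} (X : Fin s → Type*) [∀ i, Fintype (X i)] : ℕ :=
  ∑ i, partSize X i

/-- The number `n_{ip}` of vertices of the part `X i` that lie in the component `p` of `F`. -/
noncomputable def partCompSize {s : ℕ} {X : Fin s → Type*}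
    (F : SimpleGraph (Σ i, X i)) (i : Fin s) (p : F.ConnectedComponent) : ℕ :=
  {v : X i | (⟨i, v⟩ : Σ i, X i) ∈ p.supp}.ncard

/-- The number `m_p` of vertices of the component `p` of `F`. -/
noncomputable def compSize {s : ℕ} {X : Fin s → Type*}
    (F : SimpleGraph (Σ i, X i)) (p : F.ConnectedComponent) : ℕ :=
  p.supp.ncard

/-- The number `α_p = n m_p - ∑ i, n_i n_{ip}`. -/
noncomputable def alpha {s : ℕ} {X : Fin s → Type*} [∀ i, Fintype (X i)]
    (F : SimpleGraph (Σ i, X i)) (p : F.ConnectedComponent) : ℝ :=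
  (order X : ℝ) * compSize F p - ∑ i, (partSize X i : ℝ) * partCompSize F i p

open scoped Classical in
/-- The `s × s` matrix `Z(x)` with entries
`z_{ij} = δ_{ij} + ∑ p, n_{jp} (m_p - n_{ip}) / (x - α_p)`,
where `p` runs over the components of `F`. -/
noncomputable def Z {s : ℕ} {X : Fin s → Type*} [∀ i, Fintype (X i)]
    (F : SimpleGraph (Σ i, X i)) (x : ℝ) : Matrix (Fin s) (Fin s) ℝ :=
  Matrix.of fun i j =>
    (if i = j then (1 : ℝ) else 0) +
      ∑ p : F.ConnectedComponent,
        (partCompSize F j p : ℝ) * ((compSize F p : ℝ) - partCompSize F i p) / (x - alpha F p)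

/-- The vector `b = (n_1, ..., n_s)`. -/
def b {s : ℕ} (X : Fin s → Type*) [∀ i, Fintype (X i)] : Fin s → ℝ :=
  fun i => (partSize X i : ℝ)

/-- The cofactor of `M` at the `(i, j)` entry: `(-1) ^ (i + j)` times the determinant of `M`
with row `i` and column `j` deleted. -/
def cofactor {R : Type*} [CommRing R] :
    {s : ℕ} → Matrix (Fin s) (Fin s) R → Fin s → Fin s → R
  | 0, _, i, _ => i.elim0
  | _ + 1, M, i, j =>
      (-1) ^ ((i : ℕ) + (j : ℕ)) * (M.submatrix i.succAbove j.succAbove).det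

end MultipartiteForest

namespace MultipartiteForest

open Matrix

/-! With N = (n_{ip}), B = (m_p - n_{ip}) and D = diag(α_p), one has Z(0) = I - B D⁻¹ Nᵀ, and W =
NᵀB (`weight`) is symmetric and nonnegative with row sums α_p. If Z(0)x = 0, then u = D⁻¹Nᵀx
satisfies x = Bu and Du = Wu, so u lies in the kernel of the weighted Laplacian D - W. Since s ≥ 2,
the graph of positive weights is connected, so u is constant and x is a multiple of B𝟏 = ne - b
(`exists_smul_of_incidenceZ_mulVec_eq_zero`). Symmetry of W makes b a left null vector. Corank one
then determines the adjugate up to a scalar (`exists_adjugate_eq_smul_vecMulVec`). -/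

/-- A function harmonic for a symmetric nonnegative weight takes equal values at points joined by a
positive weight. -/
lemma eq_of_harmonic {P : Type*} [Fintype P] (a : P → P → ℝ) (hs : ∀ p q, a p q = a q p)
    (h0 : ∀ p q, 0 ≤ a p q) (u : P → ℝ)
    (hu : ∀ p, (∑ q, a p q) * u p = ∑ q, a p q * u q) {p q : P} (hpq : 0 < a p q) :
    u p = u q := by
  have e1 : ∑ p, ∑ q, a p q * (u p * u p) = ∑ p, ∑ q, a p q * (u p * u q) := by
    refine Finset.sum_congr rfl fun p _ => ?_
    have h := congrArg (u p * ·) (hu p)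
    simp only [Finset.sum_mul, Finset.mul_sum] at h
    calc _ = ∑ q, u p * (a p q * u p) := Finset.sum_congr rfl fun q _ => by ring
      _ = ∑ q, u p * (a p q * u q) := h
      _ = _ := Finset.sum_congr rfl fun q _ => by ring
  have e2 : ∑ p, ∑ q, a p q * (u q * u q) = ∑ p, ∑ q, a p q * (u p * u p) := by
    rw [Finset.sum_comm]
    exact Finset.sum_congr rfl fun p _ => Finset.sum_congr rfl fun q _ => by rw [hs]
  -- The Dirichlet energy of u vanishes, hence so does each of its nonnegative terms.
  have e3 : ∑ p, ∑ q, a p q * (u p - u q) ^ 2 = 0 := by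
    calc _ = ∑ p, ∑ q, a p q * (u p * u p) + ∑ p, ∑ q, a p q * (u q * u q)
          - 2 * ∑ p, ∑ q, a p q * (u p * u q) := by
          simp only [Finset.mul_sum, ← Finset.sum_add_distrib, ← Finset.sum_sub_distrib]
          exact Finset.sum_congr rfl fun p _ => Finset.sum_congr rfl fun q _ => by ring
      _ = 0 := by rw [e2, e1]; ring
  have hn : ∀ p q, 0 ≤ a p q * (u p - u q) ^ 2 := fun p q => mul_nonneg (h0 p q) (sq_nonneg _)
  have e4 := (Finset.sum_eq_zero_iff_of_nonneg fun p _ =>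
    Finset.sum_nonneg fun q _ => hn p q).1 e3 p (Finset.mem_univ p)
  have e5 := (Finset.sum_eq_zero_iff_of_nonneg fun q _ => hn p q).1 e4 q (Finset.mem_univ q)
  have e6 := (mul_eq_zero.1 e5).resolve_left hpq.ne'
  exact sub_eq_zero.1 (pow_eq_zero_iff two_ne_zero |>.1 e6)

/-! ### The weighted graph on the columns -/

section Incidence

variable {ι P : Type*} [Fintype ι] (N : ι → P → ℝ)

/-- The weight `∑ j, N j p * (m q - N j q)` between two columns of a nonnegative matrix `N`
with column sums `m`. -/
def weight (p q : P) : ℝ := ∑ j, N j p * (∑ i, N i q - N j q)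

/-- Both sides equal m_p m_q - ∑ j, N j p * N j q. -/
lemma weight_symm (p q : P) : weight N p q = weight N q p := by
  simp only [weight, mul_sub, Finset.sum_sub_distrib, ← Finset.sum_mul]
  rw [mul_comm]
  congr 1
  exact Finset.sum_congr rfl fun _ _ => mul_comm _ _

variable {N}

lemma weight_nonneg (hN : ∀ i p, 0 ≤ N i p) (p q : P) : 0 ≤ weight N p q :=
  Finset.sum_nonneg fun j _ => mul_nonneg (hN j p) <| sub_nonneg.2 <|
    Finset.single_le_sum (f := fun i => N i q) (fun i _ => hN i q) (Finset.mem_univ j)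

lemma weight_pos (hN : ∀ i p, 0 ≤ N i p) {p q : P} {i j : ι} (hij : i ≠ j) (hi : 0 < N i p)
    (hj : 0 < N j q) : 0 < weight N p q := by
  classical
  have hle : N j q ≤ ∑ k, N k q - N i q := by
    rw [le_sub_iff_add_le, ← Finset.sum_pair (f := fun k => N k q) hij.symm]
    exact Finset.sum_le_sum_of_subset_of_nonneg (Finset.subset_univ _) fun k _ _ => hN k q
  refine (mul_pos hi (hj.trans_le hle)).trans_le ?_
  exact Finset.single_le_sum (f := fun j => N j p * (∑ i, N i q - N j q))
    (fun j _ => mul_nonneg (hN j p) <| sub_nonneg.2 <|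
      Finset.single_le_sum (f := fun i => N i q) (fun i _ => hN i q) (Finset.mem_univ j))
    (Finset.mem_univ i)

variable [Fintype P]

lemma sum_weight (p : P) :
    ∑ q, weight N p q = ∑ j, N j p * (∑ i, ∑ q, N i q - ∑ q, N j q) := by
  simp only [weight]
  rw [Finset.sum_comm]
  refine Finset.sum_congr rfl fun j _ => ?_
  rw [← Finset.mul_sum, Finset.sum_sub_distrib, Finset.sum_comm]

/-- The functions harmonic for `weight N` are constant if `N` has at least two rows, and no row
or column of `N` vanishes. -/
lemma eq_of_harmonic_weight [Nontrivial ι] (hN : ∀ i p, 0 ≤ N i p)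
    (hrow : ∀ i, ∃ p, 0 < N i p) (hcol : ∀ p, ∃ i, 0 < N i p) (u : P → ℝ)
    (hu : ∀ p, (∑ q, weight N p q) * u p = ∑ q, weight N p q * u q) (p q : P) : u p = u q := by
  have key : ∀ {p q : P} {i j : ι}, i ≠ j → 0 < N i p → 0 < N j q → u p = u q :=
    fun hij hi hj => eq_of_harmonic (weight N) (weight_symm N) (weight_nonneg hN) u hu
      (weight_pos hN hij hi hj)
  obtain ⟨i, hi⟩ := hcol p
  obtain ⟨j, hj⟩ := hcol q
  by_cases hij : i = j
  · subst hij
    -- Both columns meet row i, so a column r meeting another row k is adjacent to each of them.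
    obtain ⟨k, hk⟩ := exists_ne i
    obtain ⟨r, hr⟩ := hrow k
    exact (key hk.symm hi hr).trans (key hk hr hj)
  · exact key hij hi hj

lemma sum_weight_pos [Nontrivial ι] (hN : ∀ i p, 0 ≤ N i p)
    (hrow : ∀ i, ∃ p, 0 < N i p) (hcol : ∀ p, ∃ i, 0 < N i p) (p : P) :
    0 < ∑ q, weight N p q := by
  obtain ⟨i, hi⟩ := hcol p
  obtain ⟨k, hk⟩ := exists_ne i
  obtain ⟨r, hr⟩ := hrow k
  exact (weight_pos hN hk.symm hi hr).trans_le
    (Finset.single_le_sum (fun q _ => weight_nonneg hN p q) (Finset.mem_univ r))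

end Incidence

/-! ### Matrices of corank one -/

section RankOne

variable {K n : Type*} [Field K] [Fintype n] {M : Matrix n n K} {v w : n → K}

lemma rank_add_one_eq_card (hv0 : v ≠ 0) (hv : M *ᵥ v = 0)
    (hker : ∀ x, M *ᵥ x = 0 → ∃ c : K, x = c • v) : M.rank + 1 = Fintype.card n := by
  have h1 : LinearMap.ker M.mulVecLin = Submodule.span K {v} := by
    ext x
    rw [LinearMap.mem_ker, Matrix.mulVecLin_apply, Submodule.mem_span_singleton]
    constructor
    · intro h
      obtain ⟨c, hc⟩ := hker x h
      exact ⟨c, hc.symm⟩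
    · rintro ⟨c, rfl⟩
      rw [Matrix.mulVec_smul, hv, smul_zero]
  have h2 := LinearMap.finrank_range_add_finrank_ker M.mulVecLin
  rwa [h1, finrank_span_singleton hv0, Module.finrank_fintype_fun_eq_card] at h2

lemma exists_smul_of_mulVec_eq_zero (hr : M.rank + 1 = Fintype.card n) (hv0 : v ≠ 0)
    (hv : M *ᵥ v = 0) {x : n → K} (hx : M *ᵥ x = 0) : ∃ c : K, x = c • v := by
  have h2 := LinearMap.finrank_range_add_finrank_ker M.mulVecLin
  rw [Module.finrank_fintype_fun_eq_card, ← hr] at h2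
  have h3 : Module.finrank K (LinearMap.ker M.mulVecLin) = 1 := Nat.add_left_cancel h2
  have hv' : v ∈ LinearMap.ker M.mulVecLin := hv
  obtain ⟨c, hc⟩ := exists_smul_eq_of_finrank_eq_one h3
    (x := ⟨v, hv'⟩) (fun h => hv0 (congrArg Subtype.val h)) ⟨x, hx⟩
  exact ⟨c, (congrArg Subtype.val hc).symm⟩

/-- The adjugate of a matrix of corank one is a multiple of the product of a right and a left
null vector. -/
lemma exists_adjugate_eq_smul_vecMulVec [DecidableEq n] (hr : M.rank + 1 = Fintype.card n)
    (hv0 : v ≠ 0) (hv : M *ᵥ v = 0) (hw0 : w ≠ 0) (hw : w ᵥ* M = 0) :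
    ∃ γ : K, M.adjugate = γ • vecMulVec v w := by
  have hdet : M.det = 0 := Matrix.exists_mulVec_eq_zero_iff.1 ⟨v, hv0, hv⟩
  have hcols : ∀ j, ∃ c : K, M.adjugate.col j = c • v := fun j =>
    exists_smul_of_mulVec_eq_zero hr hv0 hv <| by
      have h := M.mul_adjugate
      rw [hdet, zero_smul] at h
      ext i
      exact congrFun (congrFun h i) j
  choose c hc using hcols
  have hadj : ∀ i j, M.adjugate i j = c j * v i := fun i j => congrFun (hc j) i
  obtain ⟨k, hk⟩ := Function.ne_iff.1 hv0
  -- Row k of adj(M) M = 0 is v k times cᵀM, and v k ≠ 0.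
  have hc0 : Mᵀ *ᵥ c = 0 := by
    have h := M.adjugate_mul
    rw [hdet, zero_smul] at h
    ext j
    have h' := congrFun (congrFun h k) j
    simp only [Matrix.mul_apply, hadj, Matrix.zero_apply] at h'
    refine (mul_eq_zero.1 (?_ : v k * _ = 0)).resolve_left hk
    rw [← h']
    simp only [mulVec, dotProduct, transpose_apply, Finset.mul_sum]
    exact Finset.sum_congr rfl fun i _ => by ring
  obtain ⟨γ, hγ⟩ := exists_smul_of_mulVec_eq_zero (M := Mᵀ) (by rwa [rank_transpose]) hw0
    (by rwa [mulVec_transpose]) hc0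
  refine ⟨γ, ?_⟩
  ext i j
  rw [hadj, hγ]
  simp only [Pi.smul_apply, Matrix.smul_apply, vecMulVec_apply, smul_eq_mul]
  ring

end RankOne

lemma adjugate_eq_cofactor {R : Type*} [CommRing R] {s : ℕ} (M : Matrix (Fin s) (Fin s) R)
    (i j : Fin s) : M.adjugate j i = cofactor M i j := by
  cases s with
  | zero => exact i.elim0
  | succ s => rw [Matrix.adjugate_fin_succ_eq_det_submatrix]; rfl

/-! ### Null vectors of Z(0) -/

section Incidence

variable {ι P : Type*} [Fintype ι] [DecidableEq ι] [Fintype P]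

/-- The matrix `δ_{ij} - ∑ p, N j p * (m p - N i p) / α p`, where `m` are the column sums of `N`
and `α p = ∑ j, N j p * (n - b j)` with the row sums `b` and the total sum `n`. -/
noncomputable def incidenceZ (N : ι → P → ℝ) : Matrix ι ι ℝ :=
  1 - of fun i j => ∑ p, N j p * (∑ k, N k p - N i p) / ∑ q, weight N p q

variable {N : ι → P → ℝ}

lemma incidenceZ_mulVec (x : ι → ℝ) (i : ι) :
    (incidenceZ N *ᵥ x) i =
      x i - ∑ p, (∑ k, N k p - N i p) * ((∑ j, N j p * x j) / ∑ q, weight N p q) := by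
  rw [incidenceZ, sub_mulVec, one_mulVec, Pi.sub_apply]
  congr 1
  simp only [mulVec, dotProduct, of_apply, Finset.sum_mul, Finset.sum_div, Finset.mul_sum]
  rw [Finset.sum_comm]
  exact Finset.sum_congr rfl fun p _ => Finset.sum_congr rfl fun j _ => by ring

/-- For this vector every quotient in `incidenceZ_mulVec` is 1, by `sum_weight`. -/
lemma incidenceZ_mulVec_eq_zero (hα : ∀ p, ∑ q, weight N p q ≠ 0) :
    incidenceZ N *ᵥ (fun j => ∑ i, ∑ q, N i q - ∑ q, N j q) = 0 := by
  ext i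
  simp only [incidenceZ_mulVec, ← sum_weight, div_self (hα _), mul_one, Finset.sum_sub_distrib,
    Pi.zero_apply]
  rw [Finset.sum_comm (f := fun p k => N k p), sub_self]

/-- Here bᵀB = 𝟏ᵀNᵀB lists the column sums of W, which by symmetry are its row sums and cancel the
denominators. -/
lemma vecMul_incidenceZ_eq_zero (hα : ∀ p, ∑ q, weight N p q ≠ 0) :
    (fun j => ∑ q, N j q) ᵥ* incidenceZ N = 0 := by
  have key : ∀ p, ∑ i, (∑ q, N i q) * (∑ k, N k p - N i p) = ∑ q, weight N p q := fun p => by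
    rw [Finset.sum_congr rfl fun q _ => weight_symm N p q]
    simp only [weight, Finset.sum_mul]
    exact Finset.sum_comm
  rw [incidenceZ, vecMul_sub, vecMul_one, sub_eq_zero]
  ext j
  simp only [vecMul, dotProduct, of_apply, Finset.mul_sum]
  rw [Finset.sum_comm]
  refine Finset.sum_congr rfl fun p _ => ?_
  calc N j p = N j p * (∑ i, (∑ q, N i q) * (∑ k, N k p - N i p)) / ∑ q, weight N p q := by
        rw [key, mul_div_cancel_right₀ _ (hα p)]
    _ = _ := by
        rw [Finset.mul_sum, Finset.sum_div]
        exact Finset.sum_congr rfl fun i _ => by ring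

lemma exists_smul_of_incidenceZ_mulVec_eq_zero [Nontrivial ι] (hN : ∀ i p, 0 ≤ N i p)
    (hrow : ∀ i, ∃ p, 0 < N i p) (hcol : ∀ p, ∃ i, 0 < N i p) {x : ι → ℝ}
    (hx : incidenceZ N *ᵥ x = 0) :
    ∃ c : ℝ, x = c • fun j => ∑ i, ∑ q, N i q - ∑ q, N j q := by
  have hα := fun p => (sum_weight_pos hN hrow hcol p).ne'
  set u : P → ℝ := fun p => (∑ j, N j p * x j) / ∑ q, weight N p q with hu
  have hxu : ∀ i, x i = ∑ p, (∑ k, N k p - N i p) * u p := fun i =>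
    sub_eq_zero.1 ((incidenceZ_mulVec x i).symm.trans (congrFun hx i))
  have harm : ∀ p, (∑ q, weight N p q) * u p = ∑ q, weight N p q * u q := fun p => by
    rw [hu, mul_div_cancel₀ _ (hα p), ← hu]
    simp only [weight, Finset.sum_mul]
    rw [Finset.sum_comm]
    refine Finset.sum_congr rfl fun j _ => ?_
    rw [hxu, Finset.mul_sum]
    exact Finset.sum_congr rfl fun q _ => by ring
  have hconst := eq_of_harmonic_weight hN hrow hcol u harm
  obtain ⟨i₀⟩ : Nonempty ι := inferInstance
  obtain ⟨p₀, -⟩ := hrow i₀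
  refine ⟨u p₀, ?_⟩
  ext i
  rw [hxu, Pi.smul_apply, smul_eq_mul, Finset.sum_congr rfl fun p _ => by rw [hconst p p₀],
    ← Finset.sum_mul, Finset.sum_sub_distrib, Finset.sum_comm, mul_comm]

end Incidence

/-! ### Counting vertices by part and component -/

section Counting

variable {s : ℕ} {X : Fin s → Type*} [∀ i, Fintype (X i)] (F : SimpleGraph (Σ i, X i))

lemma sum_partCompSize [Fintype F.ConnectedComponent] (i : Fin s) :
    ∑ p, partCompSize F i p = partSize X i := by
  classical
  rw [partSize, ← Finset.card_univ, Finset.card_eq_sum_card_fiberwise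
    (f := fun v : X i => F.connectedComponentMk ⟨i, v⟩) (t := Finset.univ) (by simp)]
  refine Finset.sum_congr rfl fun p _ => ?_
  rw [partCompSize, ← Set.ncard_coe_finset]
  congr 1
  ext v
  simp [SimpleGraph.ConnectedComponent.mem_supp_iff]

lemma sum_partCompSize_eq_compSize (p : F.ConnectedComponent) :
    ∑ i, partCompSize F i p = compSize F p := by
  classical
  rw [compSize, Set.ncard_eq_toFinset_card', Finset.card_eq_sum_card_fiberwise
    (f := Sigma.fst) (t := Finset.univ) (by simp)]
  refine Finset.sum_congr rfl fun i _ => ?_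
  rw [partCompSize, Set.ncard_eq_toFinset_card']
  refine Finset.card_bij (fun v _ => ⟨i, v⟩) (fun v hv => by simpa using hv)
    (fun v _ w _ h => by simpa using h) ?_
  rintro ⟨k, v⟩ h
  obtain ⟨h1, rfl⟩ : _ ∧ k = i := by simpa using h
  exact ⟨v, by simpa using h1, rfl⟩

lemma partCompSize_pos (i : Fin s) (v : X i) :
    0 < partCompSize F i (F.connectedComponentMk ⟨i, v⟩) :=
  (Set.ncard_pos (Set.toFinite _)).2 ⟨v, rfl⟩

lemma alpha_eq [Fintype F.ConnectedComponent] (p : F.ConnectedComponent) :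
    alpha F p = ∑ q, weight (fun i p => (partCompSize F i p : ℝ)) p q := by
  rw [sum_weight, alpha, order, ← sum_partCompSize_eq_compSize]
  push_cast [← sum_partCompSize F]
  simp only [mul_sub, Finset.sum_sub_distrib]
  rw [← Finset.sum_mul, mul_comm]
  congr 1
  exact Finset.sum_congr rfl fun i _ => mul_comm _ _

lemma Z_zero_eq [Fintype F.ConnectedComponent] :
    Z F 0 = incidenceZ (fun i p => (partCompSize F i p : ℝ)) := by
  classical
  ext i j
  rw [Z, incidenceZ, Matrix.sub_apply, of_apply, of_apply, sub_eq_add_neg, Matrix.one_apply,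
    ← Finset.sum_neg_distrib]
  congr 1
  refine Finset.sum_congr (by ext; simp) fun p _ => ?_
  rw [alpha_eq, ← sum_partCompSize_eq_compSize, zero_sub, div_neg]
  push_cast
  rfl

end Counting

end MultipartiteForest

open Matrix MultipartiteForest in
theorem mainTheorem6 {s : ℕ} (hs : 2 ≤ s)
    (X : Fin s → Type*) [∀ i, Fintype (X i)] [∀ i, Nonempty (X i)]
    (F : SimpleGraph (Σ i, X i))
    (hF : F ≤ SimpleGraph.completeMultipartiteGraph X) (hF' : F.IsAcyclic) :
    (MultipartiteForest.Z F 0).rank = s - 1 ∧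
    ∃ γ : ℝ,
      (MultipartiteForest.Z F 0).adjugate =
        γ • Matrix.vecMulVec
          ((MultipartiteForest.order X : ℝ) • (1 : Fin s → ℝ) - MultipartiteForest.b X)
          (MultipartiteForest.b X) ∧
      ∀ i j : Fin s,
        γ = MultipartiteForest.cofactor (MultipartiteForest.Z F 0) i j /
          ((MultipartiteForest.partSize X i : ℝ) *
            ((MultipartiteForest.order X : ℝ) - MultipartiteForest.partSize X j)) := by
  classical
  have : Nontrivial (Fin s) := Fin.nontrivial_iff_two_le.2 hs
  let N : Fin s → F.ConnectedComponent → ℝ := fun i p => partCompSize F i p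
  have hN : ∀ i p, 0 ≤ N i p := fun i p => Nat.cast_nonneg _
  have hrow : ∀ i, ∃ p, 0 < N i p := fun i =>
    ⟨_, Nat.cast_pos.2 (partCompSize_pos F i (Classical.arbitrary (X i)))⟩
  have hcol : ∀ p, ∃ i, 0 < N i p := fun p => by
    induction p using SimpleGraph.ConnectedComponent.ind with
    | h v => exact ⟨v.1, Nat.cast_pos.2 (partCompSize_pos F v.1 v.2)⟩
  have hα := fun p => (sum_weight_pos hN hrow hcol p).ne'
  have hb : (fun j => ∑ q, N j q) = b X := by
    ext j
    simp only [N, b, ← sum_partCompSize F, Nat.cast_sum]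
  have hv : (fun j => ∑ i, ∑ q, N i q - ∑ q, N j q) = (order X : ℝ) • (1 : Fin s → ℝ) - b X := by
    rw [← hb]
    ext j
    simp only [N, order, ← sum_partCompSize F, Nat.cast_sum, Pi.sub_apply, Pi.smul_apply,
      Pi.one_apply, smul_eq_mul, mul_one]
  have hbpos : ∀ i, 0 < (partSize X i : ℝ) := fun i => Nat.cast_pos.2 Fintype.card_pos
  have hvpos : ∀ j, 0 < (order X : ℝ) - partSize X j := fun j => by
    obtain ⟨k, hk⟩ := exists_ne j
    rw [sub_pos, Nat.cast_lt, order]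
    exact Finset.single_lt_sum hk (Finset.mem_univ j) (Finset.mem_univ k) Fintype.card_pos
      fun _ _ _ => Nat.zero_le _
  have i₀ : Fin s := Classical.arbitrary _
  have hZ : Z F 0 = incidenceZ N := Z_zero_eq F
  have hZv : Z F 0 *ᵥ ((order X : ℝ) • (1 : Fin s → ℝ) - b X) = 0 := by
    rw [hZ, ← hv]; exact incidenceZ_mulVec_eq_zero hα
  have hbZ : b X ᵥ* Z F 0 = 0 := by
    rw [hZ, ← hb]; exact vecMul_incidenceZ_eq_zero hα
  have hv0 : (order X : ℝ) • (1 : Fin s → ℝ) - b X ≠ 0 := fun h =>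
    (hvpos i₀).ne' (by simpa [b] using congrFun h i₀)
  have hb0 : b X ≠ 0 := fun h => (hbpos i₀).ne' (congrFun h i₀)
  have hrank : (Z F 0).rank + 1 = Fintype.card (Fin s) :=
    rank_add_one_eq_card hv0 hZv fun x hx => by
      rw [hZ] at hx
      rw [← hv]
      exact exists_smul_of_incidenceZ_mulVec_eq_zero hN hrow hcol hx
  obtain ⟨γ, hγ⟩ := exists_adjugate_eq_smul_vecMulVec hrank hv0 hZv hb0 hbZ
  refine ⟨Nat.eq_sub_of_add_eq (hrank.trans (Fintype.card_fin s)), γ, hγ, fun i j => ?_⟩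
  -- The cofactor at (i, j) is the adjugate entry at (j, i), that is γ (n - n_j) n_i.
  rw [eq_div_iff (mul_pos (hbpos i) (hvpos j)).ne', ← adjugate_eq_cofactor, hγ]
  simp only [Matrix.smul_apply, Matrix.vecMulVec_apply, Pi.sub_apply, Pi.smul_apply, Pi.one_apply,
    smul_eq_mul, b]
  ring
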